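/- Strings are finite words over $\{0,1\}$, sets are sets of strings, and a set $A$ is identified with its characteristic function. For $n\ge 0$ let $F_n^A(z_1,\dots,z_n)=(A(z_1),\dots,A(z_n))\in\{0,1\}^n$. A quantum oracle Turing machine has finitely many states (among them a start, a halting, a pre-query and a post-query state), a finite alphabet, an input, a query and an output tape and finitely many work tapes, and a transition function with complex (here even algebraic) amplitudes such that, for every oracle, the time evolution on superpositions of configurations is unitary. In the pre-query state it passes to the post-query state, and a query tape holding $x$ followed by a bit $b$ changes to $x$ followed by $b\oplus X(x)$, where $X$ is the oracle (query tapes of any other form, and everything else, are left unchanged). It halts at time $T$ if at time $T$ all configurations with non-zero amplitude are in the halting state and at no earlier time any of them is. For a function $q:\mathbb N\to\mathbb N$, $\mathrm{FEQP}^{X[q]}$ is the class of functions $f$ for which there are such a machine and a polynomial $p$ such that on every (coded) input $a$ of length $m$ the machine with oracle $X$ halts at some time $T\le p(m)$, a measurement at time $T$ finds $f(a)$ on the output tape with probability $1$, and every computation path of length $T$ contains at most $q(m)$ queries. Tuples are coded as binary strings by replacing each bit $b$ by $0b$ and ending each component with $10$; the pair $\langle z_1\cdots z_n,x\rangle$ with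 $x\in\{0,1\}^n$ is coded as the code of $(z_1,\dots,z_n)$, followed by $11$, followed by $x$. **Theorem.** Let $A$ be any set, and let $$X=\Bigl\{\langle z_1\cdots z_n,x\rangle \;\Big|\; n\ge 0,\ x\in\{0,1\}^n,\ \sum_{i=1}^n A(z_i)\,x_i\equiv 1 \pmod 2\Bigr\}.$$ Then $F_n^A\in \mathrm{FEQP}^{X[1]}$ for all $n$. Consequently no set is superterse in the exact quantum setting: for no set $A$ is it true that $F_n^A\notin\mathrm{FEQP}^{Y[n-1]}$ for all $n\ge 1$ and all sets $Y$. -/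

import Mathlib

/-! ### Tapes -/

/-- Tape symbols: the blank, the two bits, and finitely many further symbols from `E`. -/
inductive TapeSymbol (E : Type) where
  | blank : TapeSymbol E
  | bit : Bool → TapeSymbol E
  | extra : E → TapeSymbol E
  deriving DecidableEq, Fintype

/-- The blank is the zero, so that `ℤ →₀ TapeSymbol E` is the type of two-way infinite tapes
with finitely many non-blank cells. -/
instance TapeSymbol.instZero (E : Type) : Zero (TapeSymbol E) := ⟨TapeSymbol.blank⟩

/-- A two-way infinite tape, blank outside a finite set of cells. -/
abbrev QTape (E : Type) : Type := ℤ →₀ TapeSymbol E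

/-- The symbol in cell `i` of the tape on which the string `w` is written. -/
def stringCell (E : Type) (w : List Bool) (i : ℤ) : TapeSymbol E :=
  if i < 0 then TapeSymbol.blank
  else match w[i.toNat]? with
    | some b => TapeSymbol.bit b
    | none => TapeSymbol.blank

theorem stringCell_mem (E : Type) (w : List Bool) (i : ℤ) (h : stringCell E w i ≠ 0) :
    i ∈ Finset.Ico (0 : ℤ) w.length := by
  rw [Finset.mem_Ico]
  by_contra hc
  apply h
  unfold stringCell
  split_ifs with h0
  · rfl
  · have : w.length ≤ i.toNat := by omega
    rw [List.getElem?_eq_none this]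
    rfl

/-- The tape that holds `w` in the cells `0, 1, …, |w| - 1` and is blank elsewhere. -/
noncomputable def stringTape (E : Type) (w : List Bool) : QTape E :=
  Finsupp.onFinset (Finset.Ico (0 : ℤ) w.length) (stringCell E w) (stringCell_mem E w)

theorem stringTape_injective (E : Type) : Function.Injective (stringTape E) := by
  intro v w h
  apply List.ext_getElem?
  intro n
  have h1 : stringCell E v (n : ℤ) = stringCell E w (n : ℤ) := DFunLike.congr_fun h (n : ℤ)
  have h0 : ¬ ((n : ℤ) < 0) := by omega
  simp only [stringCell, h0, if_false, Int.toNat_natCast] at h1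
  rcases hv : v[n]? with _ | a <;> rcases hw : w[n]? with _ | b <;> simp_all

open Classical in
/-- The answer of the oracle `A` on the query tape: a tape holding `x` followed by the bit `b`
becomes the tape holding `x` followed by `b ⊕ A(x)`; every other tape is left unchanged. -/
noncomputable def oracleTape {E : Type} (A : Set (List Bool)) (t : QTape E) : QTape E :=
  if h : ∃ p : List Bool × Bool, t = stringTape E (p.1 ++ [p.2]) then
    stringTape E (h.choose.1 ++ [xor h.choose.2 (decide (h.choose.1 ∈ A))])
  else t

open Classical in
/-- The choice in `oracleTape` is forced. -/
theorem oracleTape_stringTape {E : Type} (A : Set (List Bool)) (x : List Bool) (b : Bool) :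
    oracleTape A (stringTape E (x ++ [b])) = stringTape E (x ++ [xor b (decide (x ∈ A))]) := by
  have h : ∃ p : List Bool × Bool,
      stringTape E (x ++ [b]) = stringTape E (p.1 ++ [p.2]) := ⟨(x, b), rfl⟩
  have hs := List.append_inj' (stringTape_injective E h.choose_spec) rfl
  have h2 : b = h.choose.2 := by simpa using hs.2
  unfold oracleTape
  rw [dif_pos h, ← hs.1, ← h2]

/-! ### Quantum oracle Turing machines -/

/-- The data of a quantum oracle Turing machine: a finite set of states, a finite tape alphabet,
an input tape (index `0`), a query tape (index `1`), an output tape (index `2`) and `work` further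
tapes, and a transition function with complex amplitudes. In state `q`, scanning the symbols `s`,
the machine enters state `a.1`, writes the symbols `a.2.1` and moves its heads by `a.2.2`
(each `-1`, `0` or `1`) with amplitude `δ q s a`. The values of `δ` at `pre` are not used. -/
structure OracleQTM where
  Q : Type
  fintypeQ : Fintype Q
  E : Type
  fintypeE : Fintype E
  work : ℕ
  start : Q
  pre : Q
  post : Q
  halt : Q
  δ : Q → (Fin (work + 3) → TapeSymbol E) →
    Q × (Fin (work + 3) → TapeSymbol E) × (Fin (work + 3) → SignType) → ℂ

namespace OracleQTM

instance instFintypeQ (M : OracleQTM) : Fintype M.Q := M.fintypeQ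

instance instFintypeE (M : OracleQTM) : Fintype M.E := M.fintypeE

/-- What the machine can do in one ordinary step: new state, written symbols, head moves. -/
abbrev Action (M : OracleQTM) : Type :=
  M.Q × (Fin (M.work + 3) → TapeSymbol M.E) × (Fin (M.work + 3) → SignType)

/-- A classical configuration. -/
@[ext]
structure Cfg (M : OracleQTM) where
  state : M.Q
  tape : Fin (M.work + 3) → QTape M.E
  head : Fin (M.work + 3) → ℤ

/-- Superpositions of finitely many configurations (not necessarily normalised). -/
abbrev Superposition (M : OracleQTM) : Type := M.Cfg →₀ ℂ

/-- The scanned symbols. -/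
def Cfg.scan {M : OracleQTM} (c : M.Cfg) : Fin (M.work + 3) → TapeSymbol M.E :=
  fun i => c.tape i (c.head i)

/-- The configuration after an ordinary step. -/
noncomputable def Cfg.act {M : OracleQTM} (c : M.Cfg) (a : M.Action) : M.Cfg where
  state := a.1
  tape := fun i => (c.tape i).update (c.head i) (a.2.1 i)
  head := fun i => c.head i + (a.2.2 i : ℤ)

/-- The configuration after a query to `A`. -/
noncomputable def Cfg.query {M : OracleQTM} (A : Set (List Bool)) (c : M.Cfg) : M.Cfg where
  state := M.post
  tape := Function.update c.tape 1 (oracleTape A (c.tape 1))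
  head := c.head

open Classical in
/-- One step from a configuration: the oracle call in the pre-query state, the transition
function in every other state. -/
noncomputable def step (M : OracleQTM) (A : Set (List Bool)) (c : M.Cfg) : M.Superposition :=
  if c.state = M.pre then Finsupp.single (c.query A) 1
  else ∑ a : M.Action, Finsupp.single (c.act a) (M.δ c.state c.scan a)

/-- The time evolution: the linear extension of `step`. -/
noncomputable def evolve (M : OracleQTM) (A : Set (List Bool)) :
    M.Superposition →ₗ[ℂ] M.Superposition :=
  Finsupp.linearCombination ℂ (M.step A)

/-- The squared `ℓ²`-norm. -/
noncomputable def normSq {M : OracleQTM} (ψ : M.Superposition) : ℝ :=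
  ψ.sum fun _ z => ‖z‖ ^ 2

/-- The time evolution is unitary, whatever the oracle. (Every configuration has only finitely
many predecessors and successors, so a norm preserving bijection of the finitely supported
superpositions is the same thing as a unitary operator on `ℓ²` of the configurations.) -/
def WellFormed (M : OracleQTM) : Prop :=
  ∀ A : Set (List Bool),
    (∀ ψ : M.Superposition, normSq (M.evolve A ψ) = normSq ψ) ∧ Function.Bijective (M.evolve A)

/-- All amplitudes are algebraic numbers; no information can be hidden in them. -/
def AlgebraicAmplitudes (M : OracleQTM) : Prop :=
  ∀ (q : M.Q) (s : Fin (M.work + 3) → TapeSymbol M.E) (a : M.Action), IsAlgebraic ℚ (M.δ q s a)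

/-- The initial configuration: the input on the input tape, all other tapes blank, all heads on
cell `0`. -/
noncomputable def init (M : OracleQTM) (w : List Bool) : M.Cfg where
  state := M.start
  tape := Function.update (fun _ => 0) 0 (stringTape M.E w)
  head := fun _ => 0

/-- The superposition after `t` steps on input `w`. -/
noncomputable def run (M : OracleQTM) (A : Set (List Bool)) (w : List Bool) (t : ℕ) :
    M.Superposition :=
  (M.evolve A)^[t] (Finsupp.single (M.init w) 1)

/-- The machine halts after exactly `T` steps: then all configurations are in the halting state,
and none was before. -/
def HaltsAt (M : OracleQTM) (A : Set (List Bool)) (w : List Bool) (T : ℕ) : Prop :=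
  (∀ c ∈ (M.run A w T).support, c.state = M.halt) ∧
    ∀ t < T, ∀ c ∈ (M.run A w t).support, c.state ≠ M.halt

open Classical in
/-- The probability that a measurement after `T` steps finds the string `v` on the output tape. -/
noncomputable def outputProb (M : OracleQTM) (A : Set (List Bool)) (w : List Bool) (T : ℕ)
    (v : List Bool) : ℝ :=
  ∑ c ∈ (M.run A w T).support with c.tape 2 = stringTape M.E v, ‖M.run A w T c‖ ^ 2

/-- `γ 0, …, γ T` is a computation path on input `w`: each configuration occurs with non-zero
amplitude among the successors of the one before. -/
def IsPath (M : OracleQTM) (A : Set (List Bool)) (w : List Bool) (T : ℕ) (γ : ℕ → M.Cfg) : Prop :=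
  γ 0 = M.init w ∧ ∀ t < T, M.step A (γ t) (γ (t + 1)) ≠ 0

open Classical in
/-- On every computation path of length `T` the oracle is called at most `k` times. -/
def QueriesAtMost (M : OracleQTM) (A : Set (List Bool)) (w : List Bool) (T k : ℕ) : Prop :=
  ∀ γ : ℕ → M.Cfg, M.IsPath A w T γ →
    ((Finset.range T).filter fun t => (γ t).state = M.pre).card ≤ k

end OracleQTM

/-- The functions `f : α → β`, with inputs and outputs coded by bit strings, that are computed with
certainty by a quantum Turing machine with oracle `X`, in polynomial time and with at most
`q m` queries on inputs of length `m`. -/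
def FEQP {α β : Type} (encIn : α → List Bool) (encOut : β → List Bool)
    (X : Set (List Bool)) (q : ℕ → ℕ) : Set (α → β) :=
  {f | ∃ M : OracleQTM, M.WellFormed ∧ M.AlgebraicAmplitudes ∧
    ∃ p : Polynomial ℕ, ∀ a : α, ∃ T : ℕ,
      T ≤ p.eval (encIn a).length ∧
      M.HaltsAt X (encIn a) T ∧
      M.outputProb X (encIn a) T (encOut (f a)) = 1 ∧
      M.QueriesAtMost X (encIn a) T (q (encIn a).length)}

/-! ### Characteristic vectors and terseness -/

open Classical in
/-- `F_n^A(z_1, …, z_n) = (A(z_1), …, A(z_n))`. -/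
noncomputable def charVec (A : Set (List Bool)) (n : ℕ) (z : Fin n → List Bool) : Fin n → Bool :=
  fun i => decide (z i ∈ A)

/-- The inner product of two bit vectors, as a natural number. -/
def bitInner {n : ℕ} (a x : Fin n → Bool) : ℕ := ∑ i, (a i).toNat * (x i).toNat

/-- The code of a tuple of strings: the bit `b` is coded as `0b`, and every string is followed by
the end marker `10`. -/
def encodeTuple {n : ℕ} (z : Fin n → List Bool) : List Bool :=
  (List.ofFn z).flatMap fun s => (s.flatMap fun b => [false, b]) ++ [true, false]

/-- The code of the pair of a tuple of strings and a bit vector: the code of the tuple, the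
separator `11`, and the bits of the vector. -/
def encodePair {n : ℕ} (z : Fin n → List Bool) (x : Fin n → Bool) : List Bool :=
  encodeTuple z ++ [true, true] ++ List.ofFn x

/-- Superterseness with respect to exact quantum polynomial time: whatever the oracle, `n - 1`
queries never suffice to compute `F_n^A`. -/
def IsEQPSuperterse (A : Set (List Bool)) : Prop :=
  ∀ n : ℕ, 1 ≤ n → ∀ X : Set (List Bool),
    charVec A n ∉ FEQP encodeTuple List.ofFn X fun _ => n - 1

/-! The proof is the Bernstein–Vazirani algorithm. Fix `n` and put `a = F_n^A(z)`. Let `H` be the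
Hadamard transform on `n` bits and an answer bit. Start the register in `(0,…,0,1)`, apply `H`, ask
the oracle once for `a · x` with the result added to the answer bit, and apply `H` again. Since the
answer bit is in the state `(|0⟩ - |1⟩)/√2`, the query multiplies the branch of `x` by `(-1)^(a·x)`.
This turns the column of `H` at `(0,1)` into the column at `(a,1)`, and `H * H = 1` gives `(a,1)`
with certainty (`sum_hadamardTransform_kickback`).

The rest realises this on a Turing machine. Unitarity comes from the unidirectional form: a step is
a unitary matrix on the states followed by a bijection of the configurations
(`Unidirectional.wellFormed`). Only the transitions that are used have to be listed; as they form a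
functional and injective relation on a finite set, they extend to a permutation
(`exists_perm_of_biunique`).

Interference needs branches that differ in the register alone. The register is therefore kept in the
state, written behind the code of `z` for the query, and read back with erasure. All branches take
equally many steps and end with the same tapes and heads, so `run_bvMachine` finds a single final
configuration. The query bound concerns all paths, also those whose amplitudes cancel, and is proved
separately in `safe_bvMachine`. One query is `n - 1` queries for `n = 2`, so no set is superterse.
-/

open Matrix

/-! ### Unidirectional machines

A step of such a machine is a unitary operation on the states, followed by a permutation of the
pairs of a state and scanned symbols, followed by head moves that depend only on the new state. -/

theorem oracleTape_involutive {E : Type} (A : Set (List Bool)) :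
    Function.Involutive (oracleTape (E := E) A) := by
  intro t
  by_cases h : ∃ p : List Bool × Bool, t = stringTape E (p.1 ++ [p.2])
  · obtain ⟨⟨x, b⟩, rfl⟩ := h
    simp only [oracleTape_stringTape, Bool.xor_assoc, Bool.xor_self, Bool.xor_false]
  · have : oracleTape A t = t := by unfold oracleTape; rw [dif_neg h]
    rw [this, this]

namespace OracleQTM

variable {M : OracleQTM}

open Classical in
/-- A presentation of the transition function of a machine as that of a unidirectional machine. -/
structure Unidirectional (M : OracleQTM) where
  /-- The unitary operation on the states. -/
  mix : Matrix M.Q M.Q ℂ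
  /-- The reversible classical transition. -/
  rule : Equiv.Perm (M.Q × (Fin (M.work + 3) → TapeSymbol M.E))
  /-- The head moves on entering a state. -/
  dir : M.Q → Fin (M.work + 3) → SignType
  conjTranspose_mul_mix : mixᴴ * mix = 1
  mix_pre_left : ∀ q, mix M.pre q = if q = M.pre then 1 else 0
  mix_pre_right : ∀ q, mix q M.pre = if q = M.pre then 1 else 0
  rule_pre : ∀ s, rule (M.pre, s) = (M.post, s)
  dir_post : dir M.post = 0
  δ_eq : ∀ q s a, M.δ q s a = ∑ p : M.Q,
    if a = ((rule (p, s)).1, (rule (p, s)).2, dir (rule (p, s)).1) then mix p q else 0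

namespace Unidirectional

/-- The configuration with another state. -/
def setState (c : M.Cfg) (p : M.Q) : M.Cfg := ⟨p, c.tape, c.head⟩

/-- The classical part of an ordinary step. -/
noncomputable def move (U : M.Unidirectional) (c : M.Cfg) : M.Cfg :=
  c.act ((U.rule (c.state, c.scan)).1, (U.rule (c.state, c.scan)).2,
    U.dir (U.rule (c.state, c.scan)).1)

open Classical in
/-- The classical part of a step. -/
noncomputable def next (U : M.Unidirectional) (A : Set (List Bool)) (c : M.Cfg) : M.Cfg :=
  if c.state = M.pre then c.query A else move U c

/-- Applying a local map to the state and the scanned symbols. -/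
noncomputable def localMap
    (e : Equiv.Perm (M.Q × (Fin (M.work + 3) → TapeSymbol M.E))) (c : M.Cfg) : M.Cfg :=
  ⟨(e (c.state, c.scan)).1,
    fun i => (c.tape i).update (c.head i) ((e (c.state, c.scan)).2 i), c.head⟩

/-- Heads and unscanned cells stay as they are, so the inverse permutation meets the symbols just
written and restores the old ones. -/
theorem localMap_symm
    (e : Equiv.Perm (M.Q × (Fin (M.work + 3) → TapeSymbol M.E))) (c : M.Cfg) :
    localMap e.symm (localMap e c) = c := by
  have h : (localMap e c).scan = (e (c.state, c.scan)).2 := by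
    funext i
    simp [localMap, Cfg.scan]
  have h' : e.symm ((localMap e c).state, (localMap e c).scan) = (c.state, c.scan) := by
    rw [h]
    exact e.symm_apply_apply _
  apply Cfg.ext
  · change (e.symm ((localMap e c).state, (localMap e c).scan)).1 = _
    rw [h']
  · funext i
    change ((localMap e c).tape i).update (c.head i)
      ((e.symm ((localMap e c).state, (localMap e c).scan)).2 i) = _
    rw [h']
    ext j
    by_cases hj : j = c.head i
    · subst hj; simp [Cfg.scan]
    · simp [localMap, Finsupp.update, Function.update, hj]
  · rfl

open Classical in
/-- The oracle call, made on entering the post-query state. -/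
noncomputable def answer (A : Set (List Bool)) (c : M.Cfg) : M.Cfg :=
  ⟨c.state,
    if c.state = M.post then Function.update c.tape 1 (oracleTape A (c.tape 1)) else c.tape, c.head⟩

theorem answer_involutive (A : Set (List Bool)) :
    Function.Involutive (answer (M := M) A) := by
  intro c
  by_cases h : c.state = M.post
  · apply Cfg.ext
    · rfl
    · simp [answer, h, oracleTape_involutive A _]
    · rfl
  · apply Cfg.ext
    · rfl
    · simp [answer, h]
    · rfl

/-- Moving the heads as the state prescribes. -/
def shift (U : M.Unidirectional) (c : M.Cfg) : M.Cfg :=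
  ⟨c.state, c.tape, fun i => c.head i + (U.dir c.state i : ℤ)⟩

theorem shift_bijective (U : M.Unidirectional) : Function.Bijective (shift U) := by
  refine Function.bijective_iff_has_inverse.2
    ⟨fun c => ⟨c.state, c.tape, fun i => c.head i - (U.dir c.state i : ℤ)⟩, ?_, ?_⟩ <;>
  · intro c
    simp [shift]

/-- Writes a classical step, query or not, as a composite of three bijections. The oracle can be
applied on entering the post-query state because `rule` is injective and its values at the pre-query
state already exhaust all pairs with the post-query state, so that no other state leads there. -/
theorem next_eq (U : M.Unidirectional) (A : Set (List Bool)) :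
    next U A = shift U ∘ answer A ∘ localMap U.rule := by
  funext c
  by_cases h : c.state = M.pre
  · have hr := U.rule_pre c.scan
    apply Cfg.ext
    · simp [next, h, Cfg.query, shift, answer, localMap, hr]
    · have ht : (localMap U.rule c).tape = c.tape := by
        funext i
        ext j
        by_cases hj : j = c.head i
        · subst hj; simp [localMap, h, hr, Cfg.scan]
        · simp [localMap, Finsupp.update, Function.update, hj]
      have hs : (localMap U.rule c).state = M.post := by simp [localMap, h, hr]
      simp [next, h, Cfg.query, shift, answer, ht, hs]
    · simp [next, h, Cfg.query, shift, answer, localMap, hr, U.dir_post]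
  · have hp : (localMap U.rule c).state ≠ M.post := by
      intro hp
      apply h
      have : U.rule (c.state, c.scan) = U.rule (M.pre, (U.rule (c.state, c.scan)).2) := by
        rw [U.rule_pre]
        exact Prod.ext hp rfl
      exact congrArg Prod.fst (U.rule.injective this)
    apply Cfg.ext
    · simp [next, h, move, Cfg.act, shift, answer, localMap]
    · simp [next, h, move, Cfg.act, shift, answer, hp]
      rfl
    · simp [next, h, move, Cfg.act, shift, answer, localMap]

theorem next_bijective (U : M.Unidirectional) (A : Set (List Bool)) :
    Function.Bijective (next U A) := by
  rw [next_eq U]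
  refine (shift_bijective U).comp ((answer_involutive A).bijective.comp ?_)
  exact Function.bijective_iff_has_inverse.2
    ⟨localMap U.rule.symm, localMap_symm U.rule, localMap_symm U.rule.symm⟩

/-- A matrix acting on the state. -/
noncomputable def mixMap (V : Matrix M.Q M.Q ℂ) :
    M.Superposition →ₗ[ℂ] M.Superposition :=
  Finsupp.linearCombination ℂ fun c : M.Cfg =>
    ∑ p : M.Q, Finsupp.single (setState c p) (V p c.state)

theorem mixMap_single (V : Matrix M.Q M.Q ℂ) (c : M.Cfg) (z : ℂ) :
    mixMap V (Finsupp.single c z) =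
      ∑ p : M.Q, Finsupp.single (setState c p) (z * V p c.state) := by
  rw [mixMap, Finsupp.linearCombination_single, Finset.smul_sum]
  simp only [Finsupp.smul_single, smul_eq_mul]

theorem mixMap_mul (V W : Matrix M.Q M.Q ℂ) (ψ : M.Superposition) :
    mixMap V (mixMap W ψ) = mixMap (V * W) ψ := by
  induction ψ using Finsupp.induction_linear with
  | zero => simp
  | add f g hf hg => simp [hf, hg]
  | single c z =>
    simp only [mixMap_single, map_sum, Matrix.mul_apply, Finset.mul_sum]
    rw [Finset.sum_comm]
    refine Finset.sum_congr rfl fun p _ => ?_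
    rw [Finsupp.single_finsetSum]
    refine Finset.sum_congr rfl fun q _ => ?_
    congr 1
    simp only [setState]
    ring

open Classical in
theorem mixMap_one (ψ : M.Superposition) : mixMap 1 ψ = ψ := by
  induction ψ using Finsupp.induction_linear with
  | zero => simp
  | add f g hf hg => simp [hf, hg]
  | single c z =>
    rw [mixMap_single, Finset.sum_eq_single_of_mem c.state (Finset.mem_univ _)]
    · simp [setState]
    · intro p _ hp
      simp [Matrix.one_apply_ne hp]

theorem mixMap_apply (V : Matrix M.Q M.Q ℂ) (ψ : M.Superposition)
    (c : M.Cfg) : mixMap V ψ c = ∑ q : M.Q, V c.state q * ψ (setState c q) := by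
  classical
  induction ψ using Finsupp.induction_linear with
  | zero => simp
  | add f g hf hg => simp [hf, hg, mul_add, Finset.sum_add_distrib]
  | single d z =>
    rw [mixMap_single, Finsupp.finsetSum_apply]
    by_cases h : c.tape = d.tape ∧ c.head = d.head
    · rw [Finset.sum_eq_single_of_mem c.state (Finset.mem_univ _),
        Finset.sum_eq_single_of_mem d.state (Finset.mem_univ _)]
      · have h1 : setState d c.state = c := Cfg.ext rfl h.1.symm h.2.symm
        have h2 : setState c d.state = d := Cfg.ext rfl h.1 h.2
        rw [h1, h2, Finsupp.single_eq_same, Finsupp.single_eq_same, mul_comm]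
      · intro q _ hq
        rw [Finsupp.single_apply, if_neg, mul_zero]
        rintro rfl
        exact hq rfl
      · intro q _ hq
        rw [Finsupp.single_apply, if_neg]
        rintro rfl
        exact hq rfl
    · rw [Finset.sum_eq_zero, Finset.sum_eq_zero]
      · intro q _
        rw [Finsupp.single_apply, if_neg, mul_zero]
        rintro rfl
        exact h ⟨rfl, rfl⟩
      · intro q _
        rw [Finsupp.single_apply, if_neg]
        rintro rfl
        exact h ⟨rfl, rfl⟩

open Classical in
-- A matrix on the states acts separately on each fibre of fixed tapes and heads. Allowing any
-- finite `R` that covers the support lets one index set serve both before and after mixing.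
theorem normSq_eq_sum (ψ : M.Superposition)
    (R : Finset ((Fin (M.work + 3) → QTape M.E) × (Fin (M.work + 3) → ℤ)))
    (hR : ∀ c ∈ ψ.support, (c.tape, c.head) ∈ R) :
    normSq ψ = ∑ r ∈ R, ∑ q : M.Q, ‖ψ (⟨q, r.1, r.2⟩ : M.Cfg)‖ ^ 2 := by
  rw [← Finset.sum_product', normSq,
    Finsupp.sum_of_support_subset (s := (R ×ˢ Finset.univ).image
      fun x : ((Fin (M.work + 3) → QTape M.E) × (Fin (M.work + 3) → ℤ)) × M.Q =>
        (⟨x.2, x.1.1, x.1.2⟩ : M.Cfg))]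
  · rw [Finset.sum_image]
    rintro ⟨⟨a, b⟩, q⟩ _ ⟨⟨a', b'⟩, q'⟩ _ h
    have h' := Cfg.ext_iff.1 h
    simp only at h'
    simp [h'.1, h'.2.1, h'.2.2]
  · intro c hc
    exact Finset.mem_image.2 ⟨((c.tape, c.head), c.state), by simp [hR c hc], rfl⟩
  · simp

theorem sum_norm_sq_mulVec {ι : Type*} [Fintype ι] [DecidableEq ι] {V : Matrix ι ι ℂ}
    (hV : Vᴴ * V = 1) (v : ι → ℂ) : ∑ i, ‖(V *ᵥ v) i‖ ^ 2 = ∑ i, ‖v i‖ ^ 2 := by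
  have key : ∀ u : ι → ℂ, ((∑ i, ‖u i‖ ^ 2 : ℝ) : ℂ) = star u ⬝ᵥ u := by
    intro u
    simp [dotProduct, Complex.conj_mul']
  apply Complex.ofReal_injective
  rw [key, key, Matrix.star_mulVec, Matrix.dotProduct_mulVec, Matrix.vecMul_vecMul, hV,
    Matrix.vecMul_one]

open Classical in
theorem normSq_mixMap {V : Matrix M.Q M.Q ℂ} (hV : Vᴴ * V = 1)
    (ψ : M.Superposition) :
    normSq (mixMap V ψ) = normSq ψ := by
  set R := ψ.support.image (fun c : M.Cfg => (c.tape, c.head)) ∪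
    (mixMap V ψ).support.image (fun c : M.Cfg => (c.tape, c.head))
  rw [normSq_eq_sum ψ R fun c hc => Finset.mem_union_left _ (Finset.mem_image_of_mem _ hc),
    normSq_eq_sum _ R fun c hc => Finset.mem_union_right _ (Finset.mem_image_of_mem _ hc)]
  refine Finset.sum_congr rfl fun r _ => ?_
  rw [← sum_norm_sq_mulVec hV fun q => ψ (⟨q, r.1, r.2⟩ : M.Cfg)]
  refine Finset.sum_congr rfl fun q _ => ?_
  rw [mixMap_apply]
  rfl

theorem sum_act (U : M.Unidirectional) (c : M.Cfg) :
    ∑ a : M.Action, Finsupp.single (c.act a) (M.δ c.state c.scan a) =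
      ∑ p : M.Q, Finsupp.single (move U (setState c p)) (U.mix p c.state) := by
  classical
  simp only [U.δ_eq, Finsupp.single_finsetSum]
  rw [Finset.sum_comm]
  refine Finset.sum_congr rfl fun p _ => ?_
  rw [Finset.sum_eq_single_of_mem _ (Finset.mem_univ
    (((U.rule (p, c.scan)).1, (U.rule (p, c.scan)).2, U.dir (U.rule (p, c.scan)).1) :
      M.Action))]
  · rw [if_pos rfl]
    rfl
  · intro a _ ha
    rw [if_neg ha, Finsupp.single_zero]

/-- As `mix` fixes the pre-query state and mixes nothing into it, queries obey the same formula as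
ordinary steps. -/
theorem step_eq (U : M.Unidirectional) (A : Set (List Bool)) (c : M.Cfg) :
    M.step A c =
      ∑ p : M.Q, Finsupp.single (next U A (setState c p)) (U.mix p c.state) := by
  classical
  by_cases h : c.state = M.pre
  · rw [Finset.sum_eq_single_of_mem M.pre (Finset.mem_univ _)]
    · rw [step, if_pos h, h, U.mix_pre_right, if_pos rfl, next,
        if_pos (show (setState c M.pre).state = M.pre from rfl)]
      rfl
    · intro p _ hp
      rw [h, U.mix_pre_right, if_neg hp, Finsupp.single_zero]
  · rw [step, if_neg h, sum_act U]
    refine Finset.sum_congr rfl fun p _ => ?_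
    by_cases hp : p = M.pre
    · rw [hp, U.mix_pre_left, if_neg h, Finsupp.single_zero, Finsupp.single_zero]
    · rw [next, if_neg]
      exact hp

theorem evolve_eq (U : M.Unidirectional) (A : Set (List Bool)) (ψ : M.Superposition) :
    M.evolve A ψ = Finsupp.mapDomain (next U A) (mixMap U.mix ψ) := by
  induction ψ using Finsupp.induction_linear with
  | zero => simp
  | add f g hf hg => simp [hf, hg, Finsupp.mapDomain_add]
  | single c z =>
    rw [mixMap_single, Finsupp.mapDomain_finsetSum, evolve,
      Finsupp.linearCombination_single, step_eq U, Finset.smul_sum]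
    simp only [Finsupp.mapDomain_single, Finsupp.smul_single, smul_eq_mul]

theorem wellFormed (U : M.Unidirectional) : M.WellFormed := by
  classical
  intro A
  have he : ⇑(M.evolve A) =
      Finsupp.mapDomain (next U A) ∘ mixMap U.mix := funext (evolve_eq U A)
  refine ⟨fun ψ => ?_, ?_⟩
  · rw [he, ← normSq_mixMap U.conjTranspose_mul_mix ψ]
    exact Finsupp.sum_mapDomain_index_inj (next_bijective U A).1
  · rw [he]
    refine Function.Bijective.comp ?_ ?_
    · convert (Finsupp.domLCongr (R := ℂ) (M := ℂ)
        (Equiv.ofBijective _ (next_bijective U A))).bijective using 1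
      funext ψ
      rw [Finsupp.domLCongr_apply, Finsupp.domCongr_apply, Finsupp.equivMapDomain_eq_mapDomain]
      rfl
    · refine Function.bijective_iff_has_inverse.2 ⟨mixMap U.mixᴴ, fun ψ => ?_, fun ψ => ?_⟩
      · rw [mixMap_mul, U.conjTranspose_mul_mix, mixMap_one]
      · rw [mixMap_mul, mul_eq_one_comm.1 U.conjTranspose_mul_mix, mixMap_one]

theorem algebraicAmplitudes (U : M.Unidirectional) (h : ∀ p q, IsAlgebraic ℚ (U.mix p q)) :
    M.AlgebraicAmplitudes := by
  classical
  intro q s a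
  rw [U.δ_eq]
  refine mem_algebraicClosure_iff.1 (sum_mem fun p _ => mem_algebraicClosure_iff.2 ?_)
  split_ifs
  · exact h p q
  · exact isAlgebraic_zero

end Unidirectional

end OracleQTM

/-! ### Tapes holding a string -/

theorem stringTape_apply {E : Type} (w : List Bool) (i : ℤ) :
    stringTape E w i = stringCell E w i := rfl

theorem stringTape_length {E : Type} (w : List Bool) :
    stringTape E w w.length = TapeSymbol.blank := by
  simp [stringTape_apply, stringCell]

theorem stringTape_append_cons {E : Type} (u l : List Bool) (b : Bool) :
    stringTape E (u ++ b :: l) u.length = TapeSymbol.bit b := by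
  simp [stringTape_apply, stringCell]

theorem stringTape_nil {E : Type} : stringTape E [] = 0 := by
  ext i
  simp only [stringTape_apply, stringCell, List.getElem?_nil, ite_self]
  rfl

theorem stringTape_append_singleton_of_ne {E : Type} (u : List Bool) (b : Bool) {i : ℤ}
    (hi : i ≠ u.length) : stringTape E (u ++ [b]) i = stringTape E u i := by
  simp only [stringTape_apply, stringCell]
  split_ifs with h0
  · rfl
  · rcases lt_trichotomy i.toNat u.length with h | h | h
    · rw [List.getElem?_append_left h]
    · omega
    · rw [List.getElem?_eq_none (by simp; omega), List.getElem?_eq_none (by omega)]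

theorem stringTape_update_length {E : Type} (u : List Bool) (b : Bool) :
    (stringTape E u).update u.length (TapeSymbol.bit b) = stringTape E (u ++ [b]) := by
  classical
  ext i
  rw [Finsupp.update_apply]
  split_ifs with h
  · rw [h, stringTape_append_cons]
  · rw [stringTape_append_singleton_of_ne u b h]

theorem stringTape_erase_last {E : Type} (u : List Bool) (b : Bool) :
    (stringTape E (u ++ [b])).update u.length TapeSymbol.blank = stringTape E u := by
  classical
  ext i
  rw [Finsupp.update_apply]
  split_ifs with h
  · rw [h, stringTape_length]
  · rw [stringTape_append_singleton_of_ne u b h]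

namespace OracleQTM

variable {M : OracleQTM}

/-! ### Computation paths -/

/-- No path of length `k` from the configuration visits the halting state before its end or makes
more than `m` queries. -/
def Safe (A : Set (List Bool)) : ℕ → ℕ → M.Cfg → Prop
  | 0, _, _ => True
  | k + 1, m, c => c.state ≠ M.halt ∧ ∀ c', M.step A c c' ≠ 0 →
      (c.state = M.pre ∧ ∃ l, m = l + 1 ∧ Safe A k l c') ∨ (c.state ≠ M.pre ∧ Safe A k m c')

open Classical in
theorem Safe.card_le {A : Set (List Bool)} {k m : ℕ} {c : M.Cfg} (h : Safe A k m c)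
    (γ : ℕ → M.Cfg) (h0 : γ 0 = c) (hγ : ∀ t < k, M.step A (γ t) (γ (t + 1)) ≠ 0) :
    ((Finset.range k).filter fun t => (γ t).state = M.pre).card ≤ m := by
  induction k generalizing m c γ with
  | zero => simp
  | succ k ih =>
    have h1 := h.2 (γ 1) (h0 ▸ hγ 0 (Nat.succ_pos k))
    have key : ∀ l, Safe A k l (γ 1) →
        ∑ t ∈ Finset.range k, (if (γ (t + 1)).state = M.pre then 1 else 0) ≤ l := by
      intro l hl
      have := ih hl (fun t => γ (t + 1)) rfl fun t ht => hγ (t + 1) (by omega)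
      rwa [Finset.card_filter] at this
    rw [Finset.card_filter, Finset.sum_range_succ', h0]
    rcases h1 with ⟨hp, l, rfl, hl⟩ | ⟨hp, hl⟩
    · rw [if_pos hp]
      exact Nat.add_le_add_right (key l hl) 1
    · rw [if_neg hp]
      exact key m hl

theorem mem_support_evolve_iterate {A : Set (List Bool)} {c d : M.Cfg} {t : ℕ}
    (hd : d ∈ ((M.evolve A)^[t + 1] (Finsupp.single c 1)).support) :
    ∃ c', M.step A c c' ≠ 0 ∧ d ∈ ((M.evolve A)^[t] (Finsupp.single c' 1)).support := by
  rw [Function.iterate_succ_apply, evolve, Finsupp.linearCombination_single, one_smul,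
    ← evolve, ← Module.End.coe_pow, ← Finsupp.sum_single (M.step A c), Finsupp.sum, map_sum,
    Finsupp.mem_support_iff, Finsupp.finsetSum_apply] at hd
  obtain ⟨c', hc', hne⟩ := Finset.exists_ne_zero_of_sum_ne_zero hd
  refine ⟨c', Finsupp.mem_support_iff.1 hc', ?_⟩
  rw [← mul_one (M.step A c c'), ← smul_eq_mul, ← Finsupp.smul_single, map_smul] at hne
  rw [← Module.End.coe_pow, Finsupp.mem_support_iff]
  intro h0
  apply hne
  rw [Finsupp.smul_apply, h0, smul_zero]

/-- Amplitudes may cancel, but a configuration in the support at time `t` is always the end of some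
path of length `t`. -/
theorem Safe.state_ne_halt {A : Set (List Bool)} {k m : ℕ} {c : M.Cfg} (h : Safe A k m c)
    {t : ℕ} (ht : t < k) {d : M.Cfg}
    (hd : d ∈ ((M.evolve A)^[t] (Finsupp.single c 1)).support) : d.state ≠ M.halt := by
  induction t generalizing k m c with
  | zero =>
    obtain ⟨k, rfl⟩ : ∃ j, k = j + 1 := ⟨k - 1, by omega⟩
    have hdc : d = c := by simpa using hd
    exact hdc ▸ h.1
  | succ t ih =>
    obtain ⟨k, rfl⟩ : ∃ j, k = j + 1 := ⟨k - 1, by omega⟩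
    obtain ⟨c', hc', hmem⟩ := mem_support_evolve_iterate hd
    rcases h.2 c' hc' with ⟨_, l, _, hl⟩ | ⟨_, hl⟩
    · exact ih hl (by omega) hmem
    · exact ih hl (by omega) hmem

/-- In `k` steps, `m` of them queries, the machine passes deterministically from `c` to `c'`,
without visiting the halting state before. -/
structure Chain (A : Set (List Bool)) (k m : ℕ) (c c' : M.Cfg) : Prop where
  evolve_iterate : ∀ z : ℂ, (M.evolve A)^[k] (Finsupp.single c z) = Finsupp.single c' z
  safe : ∀ j l, Safe A j l c' → Safe A (k + j) (m + l) c

namespace Chain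

variable {A : Set (List Bool)}

theorem refl (c : M.Cfg) : Chain A 0 0 c c :=
  ⟨fun _ => rfl, fun j l h => by simpa using h⟩

/-- The field `safe` speaks of an arbitrary safe continuation, which is why step and query counts
simply add. -/
theorem trans {k k' m m' : ℕ} {c c' c'' : M.Cfg} (h : Chain A k m c c')
    (h' : Chain A k' m' c' c'') : Chain A (k + k') (m + m') c c'' := by
  refine ⟨fun z => ?_, fun j l hs => ?_⟩
  · rw [add_comm, Function.iterate_add_apply, h.evolve_iterate, h'.evolve_iterate]
  · rw [add_assoc, add_assoc]
    exact h.safe _ _ (h'.safe _ _ hs)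

theorem of_step {c c' : M.Cfg} (hs : M.step A c = Finsupp.single c' 1) (hh : c.state ≠ M.halt)
    (hp : c.state ≠ M.pre) : Chain A 1 0 c c' := by
  refine ⟨fun z => ?_, fun j l h => ?_⟩
  · simp [evolve, hs]
  · rw [add_comm, zero_add]
    refine ⟨hh, fun d hd => Or.inr ⟨hp, ?_⟩⟩
    have : d = c' := by
      by_contra hne
      exact hd (by rw [hs, Finsupp.single_eq_of_ne hne])
    exact this ▸ h

theorem of_query {c : M.Cfg} (hp : c.state = M.pre) (hh : M.pre ≠ M.halt) :
    Chain A 1 1 c (c.query A) := by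
  have hs : M.step A c = Finsupp.single (c.query A) 1 := by rw [step, if_pos hp]
  refine ⟨fun z => ?_, fun j l h => ?_⟩
  · simp [evolve, hs]
  · rw [add_comm, add_comm 1 l]
    refine ⟨hp ▸ hh, fun d hd => Or.inl ⟨hp, l, rfl, ?_⟩⟩
    have : d = c.query A := by
      by_contra hne
      exact hd (by rw [hs, Finsupp.single_eq_of_ne hne])
    exact this ▸ h

/-- The common `k` is essential: the branches stay synchronised, so linearity carries the whole
superposition along. -/
theorem evolve_iterate_sum {ι : Type*} {s : Finset ι} {k m : ℕ} {c c' : ι → M.Cfg}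
    (h : ∀ i, Chain A k m (c i) (c' i)) (z : ι → ℂ) :
    (M.evolve A)^[k] (∑ i ∈ s, Finsupp.single (c i) (z i)) =
      ∑ i ∈ s, Finsupp.single (c' i) (z i) := by
  rw [← Module.End.coe_pow, map_sum]
  refine Finset.sum_congr rfl fun i _ => ?_
  rw [Module.End.coe_pow, (h i).evolve_iterate]

end Chain

namespace Unidirectional

theorem step_eq_single (U : M.Unidirectional) (A : Set (List Bool)) {c : M.Cfg}
    (h : ∀ p, p ≠ c.state → U.mix p c.state = 0) (h1 : U.mix c.state c.state = 1) :
    M.step A c = Finsupp.single (next U A c) 1 := by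
  classical
  rw [step_eq U, Finset.sum_eq_single_of_mem c.state (Finset.mem_univ _)]
  · rw [h1]
    rfl
  · intro p _ hp
    rw [h p hp, Finsupp.single_zero]

theorem next_of_rule (U : M.Unidirectional) (A : Set (List Bool)) {c : M.Cfg}
    (hp : c.state ≠ M.pre) {q : M.Q} {s : Fin (M.work + 3) → TapeSymbol M.E}
    (h : U.rule (c.state, c.scan) = (q, s)) :
    next U A c = ⟨q, fun i => (c.tape i).update (c.head i) (s i),
      fun i => c.head i + (U.dir q i : ℤ)⟩ := by
  rw [next, if_neg hp, move, h]
  rfl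

end Unidirectional

end OracleQTM

/-! ### The Hadamard transform -/

/-- The entries of the Hadamard gate. -/
noncomputable def hadamardEntry (b c : Bool) : ℂ :=
  if b && c then -((√2 : ℝ) : ℂ)⁻¹ else ((√2 : ℝ) : ℂ)⁻¹

theorem inv_sqrt_two_mul_self : ((√2 : ℝ) : ℂ)⁻¹ * ((√2 : ℝ) : ℂ)⁻¹ = 1 / 2 := by
  rw [← mul_inv, ← Complex.ofReal_mul, Real.mul_self_sqrt (by norm_num)]
  norm_num

/-- The Hadamard transform on a register of bits. -/
noncomputable def hadamardTransform (ι : Type*) [Fintype ι] :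
    Matrix (ι → Bool) (ι → Bool) ℂ :=
  fun x y => ∏ i, hadamardEntry (x i) (y i)

theorem sum_hadamardEntry_mul (b c : Bool) :
    ∑ d, hadamardEntry b d * hadamardEntry d c = if b = c then 1 else 0 := by
  have h := inv_sqrt_two_mul_self
  cases b <;> cases c <;> simp [hadamardEntry] <;> linear_combination 2 * h

theorem hadamardTransform_mul_self (ι : Type*) [Fintype ι] [DecidableEq ι] :
    hadamardTransform ι * hadamardTransform ι = 1 := by
  ext x y
  simp only [Matrix.mul_apply, hadamardTransform, ← Finset.prod_mul_distrib]
  rw [← Fintype.prod_sum fun i d => hadamardEntry (x i) d * hadamardEntry d (y i)]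
  simp only [sum_hadamardEntry_mul]
  rw [Finset.prod_ite_zero, Matrix.one_apply]
  simp [funext_iff]

theorem hadamardTransform_conjTranspose (ι : Type*) [Fintype ι] :
    (hadamardTransform ι)ᴴ = hadamardTransform ι := by
  ext x y
  simp only [Matrix.conjTranspose_apply, hadamardTransform, star_prod]
  refine Finset.prod_congr rfl fun i _ => ?_
  cases x i <;> cases y i <;> simp [hadamardEntry]

theorem isAlgebraic_hadamardEntry (b c : Bool) : IsAlgebraic ℚ (hadamardEntry b c) := by
  have h : IsAlgebraic ℚ ((√2 : ℝ) : ℂ)⁻¹ := by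
    refine IsAlgebraic.inv ?_
    refine IsAlgebraic.of_pow (n := 2) (by norm_num) ?_
    rw [← Complex.ofReal_pow, Real.sq_sqrt (by norm_num)]
    exact_mod_cast isAlgebraic_natCast 2
  unfold hadamardEntry
  split_ifs
  · exact h.neg
  · exact h

theorem isAlgebraic_hadamardTransform {ι : Type*} [Fintype ι] (x y : ι → Bool) :
    IsAlgebraic ℚ (hadamardTransform ι x y) :=
  mem_algebraicClosure_iff.1
    (prod_mem fun i _ => mem_algebraicClosure_iff.2 (isAlgebraic_hadamardEntry (x i) (y i)))

/-- The phase kickback. -/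
theorem hadamardEntry_mul_prod {n : ℕ} (a x : Fin n → Bool) (b : Bool) :
    hadamardEntry (xor b (decide (bitInner a x % 2 = 1))) true * ∏ i, hadamardEntry (x i) false =
      hadamardEntry b true * ∏ i, hadamardEntry (x i) (a i) := by
  -- The entry is `(-1)^(cd) / √2`, so over the register the exponents add up to the inner product.
  have h1 : ∀ c d, hadamardEntry c d = (-1) ^ (d.toNat * c.toNat) * hadamardEntry c false := by
    intro c d
    cases c <;> cases d <;> simp [hadamardEntry]
  have h2 : ∏ i, hadamardEntry (x i) (a i) =
      (-1) ^ bitInner a x * ∏ i, hadamardEntry (x i) false := by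
    rw [bitInner, ← Finset.prod_pow_eq_pow_sum, ← Finset.prod_mul_distrib]
    exact Finset.prod_congr rfl fun i _ => h1 _ _
  rw [h2]
  rcases Nat.mod_two_eq_zero_or_one (bitInner a x) with h | h
  · rw [(Nat.even_iff.2 h).neg_one_pow, h]
    simp
  -- An odd inner product flips the answer bit, and this changes the sign of its entry in the column
  -- of `1`.
  · rw [(Nat.odd_iff.2 h).neg_one_pow, h]
    cases b <;> simp [hadamardEntry]

/-- Flipping the last bit of a register by the inner product of the others with `a`. -/
def kickback {n : ℕ} (a : Fin n → Bool) (r : Fin (n + 1) → Bool) : Fin (n + 1) → Bool :=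
  Fin.snoc (α := fun _ => Bool) (Fin.init r)
    (xor (r (Fin.last n)) (decide (bitInner a (Fin.init r) % 2 = 1)))

theorem kickback_involutive {n : ℕ} (a : Fin n → Bool) : Function.Involutive (kickback a) := by
  intro r
  simp only [kickback, Fin.init_snoc, Fin.snoc_last, Bool.xor_assoc, Bool.xor_self,
    Bool.xor_false]
  exact Fin.snoc_init_self r

theorem hadamardTransform_kickback {n : ℕ} (a : Fin n → Bool) (r : Fin (n + 1) → Bool) :
    hadamardTransform _ (kickback a r)
        (Fin.snoc (α := fun _ => Bool) (fun _ => false) true) =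
      hadamardTransform _ r (Fin.snoc (α := fun _ => Bool) a true) := by
  simp only [hadamardTransform, Fin.prod_univ_castSucc, kickback, Fin.snoc_castSucc,
    Fin.snoc_last]
  rw [mul_comm, hadamardEntry_mul_prod a (Fin.init r), mul_comm]
  rfl

/-- The Bernstein–Vazirani identity. -/
theorem sum_hadamardTransform_kickback {n : ℕ} (a : Fin n → Bool) (s : Fin (n + 1) → Bool) :
    ∑ r, hadamardTransform _ r (Fin.snoc (α := fun _ => Bool) (fun _ => false) true) *
        hadamardTransform _ s (kickback a r) =
      if s = Fin.snoc (α := fun _ => Bool) a true then 1 else 0 := by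
  -- Reindexing by the involution moves the kickback to the first factor, where it replaces the
  -- column `(0,1)` by `(a,1)`; what remains is an entry of `H * H`.
  rw [← Equiv.sum_comp (kickback_involutive a).toPerm]
  simp only [Function.Involutive.coe_toPerm, kickback_involutive a _, hadamardTransform_kickback]
  rw [← Matrix.one_apply, ← hadamardTransform_mul_self, Matrix.mul_apply]
  exact Finset.sum_congr rfl fun r _ => mul_comm _ _

/-! ### The codes -/

/-- Read in blocks of two, the code is unambiguous: the first bit of a block tells a coded bit `0b`
from the end marker `10`. -/
theorem flatMap_code_append_inj {s s' t t' : List Bool}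
    (h : (s.flatMap fun b => [false, b]) ++ [true, false] ++ t =
      (s'.flatMap fun b => [false, b]) ++ [true, false] ++ t') : s = s' ∧ t = t' := by
  induction s generalizing s' with
  | nil => cases s' <;> simp_all
  | cons b s ih =>
    cases s' with
    | nil => simp at h
    | cons b' s' =>
      simp only [List.flatMap_cons, List.cons_append, List.nil_append, List.cons.injEq,
        true_and] at h
      obtain ⟨h1, h2⟩ := ih h.2
      exact ⟨by rw [h.1, h1], h2⟩

theorem flatMap_tuple_append_inj {L L' : List (List Bool)} {t t' : List Bool}
    (h : (L.flatMap fun s => (s.flatMap fun b => [false, b]) ++ [true, false]) ++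
        ([true, true] ++ t) =
      (L'.flatMap fun s => (s.flatMap fun b => [false, b]) ++ [true, false]) ++
        ([true, true] ++ t')) : L = L' ∧ t = t' := by
  -- The code of a component begins with `0b` or `10`, so `11` can only be the separator.
  have hne : ∀ (s u v : List Bool), [true, true] ++ u ≠
      (s.flatMap fun b => [false, b]) ++ [true, false] ++ v := by
    intro s u v
    cases s <;> simp
  induction L generalizing L' with
  | nil =>
    cases L' with
    | nil => simpa using h
    | cons s L' =>
      rw [List.flatMap_nil, List.flatMap_cons, List.nil_append, List.append_assoc _ _ (_ ++ t')] at h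
      exact (hne _ _ _ h).elim
  | cons s L ih =>
    cases L' with
    | nil =>
      rw [List.flatMap_nil, List.flatMap_cons, List.nil_append, List.append_assoc _ _ (_ ++ t)] at h
      exact (hne _ _ _ h.symm).elim
    | cons s' L' =>
      rw [List.flatMap_cons, List.flatMap_cons, List.append_assoc _ _ (_ ++ t),
        List.append_assoc _ _ (_ ++ t')] at h
      obtain ⟨h1, h2⟩ := flatMap_code_append_inj h
      obtain ⟨h3, h4⟩ := ih h2
      exact ⟨by rw [h1, h3], h4⟩

/-- The lengths `n` and `n'` may differ, since membership in the oracle quantifies over the length.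
-/
theorem encodePair_inj {n n' : ℕ} {z : Fin n → List Bool} {z' : Fin n' → List Bool}
    {x : Fin n → Bool} {x' : Fin n' → Bool} (h : encodePair z x = encodePair z' x') :
    List.ofFn z = List.ofFn z' ∧ List.ofFn x = List.ofFn x' := by
  unfold encodePair encodeTuple at h
  rw [List.append_assoc, List.append_assoc] at h
  exact flatMap_tuple_append_inj h

/-- The oracle of inner products with the characteristic vectors of `A`. -/
def innerProductOracle (A : Set (List Bool)) : Set (List Bool) :=
  {w | ∃ (n : ℕ) (z : Fin n → List Bool) (x : Fin n → Bool),
    w = encodePair z x ∧ bitInner (charVec A n z) x ≡ 1 [MOD 2]}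

theorem encodePair_mem_innerProductOracle {A : Set (List Bool)} {n : ℕ}
    {z : Fin n → List Bool} {x : Fin n → Bool} :
    encodePair z x ∈ innerProductOracle A ↔ bitInner (charVec A n z) x % 2 = 1 := by
  constructor
  · rintro ⟨n', z', x', h, hmod⟩
    obtain ⟨h1, h2⟩ := encodePair_inj h
    obtain rfl : n = n' := by simpa using congrArg List.length h1
    rw [List.ofFn_injective h1, List.ofFn_injective h2]
    exact hmod
  · intro h
    exact ⟨n, z, x, rfl, h⟩

/-! ### The machine -/

/-- A functional and injective relation on a finite type is contained in a permutation. -/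
theorem exists_perm_of_biunique {α : Type*} [Finite α] (r : α → α → Prop)
    (hr : ∀ a b b', r a b → r a b' → b = b') (hl : ∀ a a' b, r a b → r a' b → a = a') :
    ∃ e : Equiv.Perm α, ∀ a b, r a b → e a = b := by
  classical
  cases nonempty_fintype α
  choose f hf using fun a : {a // ∃ b, r a b} => a.2
  have hinj : Function.Injective f := fun a a' h => Subtype.ext (hl _ _ _ (hf a) (h ▸ hf a'))
  let e := (Equiv.ofInjective f hinj).trans (Equiv.refl {b // b ∈ Set.range f})
  refine ⟨e.extendSubtype, fun a b h => ?_⟩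
  rw [Equiv.extendSubtype_apply_of_mem e a ⟨b, h⟩]
  exact hr _ _ _ (hf ⟨a, b, h⟩) h

noncomputable section

/-- Bit strings of bounded length. -/
abbrev BoundedString (N : ℕ) : Type := {l : List Bool // l.length ≤ N}

instance (N : ℕ) : Fintype (BoundedString N) :=
  (List.finite_length_le Bool N).fintype

/-- The states in which the machine is not about to apply the Hadamard transform. A state with
a string has to write that string, or has read it. -/
inductive Control (N : ℕ) where
  | copy : Control N
  | mark : Control N
  | pre : Control N
  | post : Control N
  | write : BoundedString N → Control N
  | read : BoundedString N → Control N
  | output : BoundedString N → Control N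
  deriving Fintype

end

/-- The states: the control states, and the states before the two applications of the Hadamard
transform, with the register. -/
abbrev BVState (n : ℕ) : Type := Control (n + 1) ⊕ (Bool × (Fin (n + 1) → Bool))

/-- The initial content of the register. -/
def initialRegister (n : ℕ) : Fin (n + 1) → Bool :=
  Fin.snoc (α := fun _ => Bool) (fun _ => false) true

open TapeSymbol in
/-- The transitions that the machine needs: state and scanned symbols before and after. -/
inductive BVRule (n : ℕ) : BVState n →
    TapeSymbol Empty → TapeSymbol Empty → TapeSymbol Empty → BVState n →
    TapeSymbol Empty → TapeSymbol Empty → TapeSymbol Empty → Prop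
  | copyBit (b o) : BVRule n (.inl .copy) (bit b) blank o (.inl .copy) (bit b) (bit b) o
  | copyEnd (o) : BVRule n (.inl .copy) blank blank o (.inl .mark) blank (bit true) o
  | mark (i o) : BVRule n (.inl .mark) i blank o (.inr (false, initialRegister n)) i (bit true) o
  | load (r l i q o) (h : l.1 = List.ofFn r) :
      BVRule n (.inr (false, r)) i q o (.inl (.write l)) i q o
  | write (b l l' i o) (h : l.1 = b :: l'.1) :
      BVRule n (.inl (.write l)) i blank o (.inl (.write l')) i (bit b) o
  | writeEnd (l i o) (h : l.1 = []) :
      BVRule n (.inl (.write l)) i blank o (.inl .pre) i blank o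
  | query (i q o) : BVRule n (.inl .pre) i q o (.inl .post) i q o
  | readStart (l i q o) (h : l.1 = []) : BVRule n (.inl .post) i q o (.inl (.read l)) i q o
  | read (b l l' i o) (h : l'.1 = b :: l.1) :
      BVRule n (.inl (.read l)) i (bit b) o (.inl (.read l')) i blank o
  | readEnd (r l i q o) (h : l.1 = List.ofFn r) :
      BVRule n (.inl (.read l)) i q o (.inr (true, r)) i q o
  | unload (r l i q o) (h : l.1 = List.ofFn r) :
      BVRule n (.inr (true, r)) i q o (.inl (.output l)) i q o
  | output (b l l' i q) (h : l.1 = b :: l'.1) :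
      BVRule n (.inl (.output l)) i q blank (.inl (.output l')) i q (bit b)

/-- A full register has the maximal length and is not the tail of a longer bounded string. This
keeps `load` apart from `write`, `unload` from `output`, and `readEnd` from `read`, which would
otherwise clash. -/
theorem BoundedString.not_cons_of_ofFn {N : ℕ} {l l' : BoundedString N} {b : Bool}
    {r : Fin N → Bool} (h : l.1 = b :: l'.1) (h' : l'.1 = List.ofFn r) : False := by
  have := l.2
  rw [h, List.length_cons, h', List.length_ofFn] at this
  omega

theorem BVRule.functional {n : ℕ} {s s₁ s₂ : BVState n} {i q o i₁ q₁ o₁ i₂ q₂ o₂}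
    (h₁ : BVRule n s i q o s₁ i₁ q₁ o₁) (h₂ : BVRule n s i q o s₂ i₂ q₂ o₂) :
    (s₁, i₁, q₁, o₁) = (s₂, i₂, q₂, o₂) := by
  cases h₁ <;> cases h₂ <;> try rfl
  all_goals
    first
    | exact (BoundedString.not_cons_of_ofFn ‹_› ‹_›).elim
    | grind [List.ofFn_inj]

/-- Reversibility holds because a bit leaves the state only when it appears on a tape, and leaves a
tape only when the state has stored it. -/
theorem BVRule.injective {n : ℕ} {s s₁ s₂ : BVState n} {i q o i₁ q₁ o₁ i₂ q₂ o₂}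
    (h₁ : BVRule n s₁ i₁ q₁ o₁ s i q o) (h₂ : BVRule n s₂ i₂ q₂ o₂ s i q o) :
    (s₁, i₁, q₁, o₁) = (s₂, i₂, q₂, o₂) := by
  cases h₁ <;> cases h₂ <;> try rfl
  all_goals
    first
    | exact (BoundedString.not_cons_of_ofFn ‹_› ‹_›).elim
    | grind [List.ofFn_inj]

open SignType in
/-- The head moves on entering a state. -/
def bvDir (n : ℕ) : BVState n → Fin 3 → SignType
  | .inl .copy => ![pos, pos, zero]
  | .inl .mark => ![zero, pos, zero]
  | .inl .pre => ![zero, zero, zero]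
  | .inl .post => ![zero, zero, zero]
  -- A string of length `n + 1` comes from the register with the head already on the first free
  -- cell; a shorter one is reached by writing a bit, after which the head must advance.
  | .inl (.write l) => ![zero, if l.1.length = n + 1 then zero else pos, zero]
  | .inl (.read _) => ![zero, neg, zero]
  | .inl (.output l) => ![zero, zero, if l.1.length = n + 1 then zero else pos]
  | .inr (false, _) => ![zero, pos, zero]
  | .inr (true, _) => ![zero, zero, zero]

open Classical in
/-- The unitary operation on the states. -/
noncomputable def bvMix (n : ℕ) : Matrix (BVState n) (BVState n) ℂ :=
  Matrix.fromBlocks 1 0 0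
    (Matrix.kronecker (1 : Matrix Bool Bool ℂ) (hadamardTransform (Fin (n + 1))))

theorem bvMix_conjTranspose_mul (n : ℕ) [DecidableEq (BVState n)] :
    (bvMix n)ᴴ * bvMix n = 1 := by
  classical
  rw [bvMix, Matrix.fromBlocks_conjTranspose, Matrix.fromBlocks_multiply]
  simp only [Matrix.kronecker]
  rw [Matrix.conjTranspose_kronecker, ← Matrix.mul_kronecker_mul, hadamardTransform_conjTranspose,
    hadamardTransform_mul_self]
  trans Matrix.fromBlocks 1 0 0 1
  · simp
  · convert Matrix.fromBlocks_one

theorem bvMix_inl_self {n : ℕ} (c : Control (n + 1)) : bvMix n (.inl c) (.inl c) = 1 := by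
  simp [bvMix]

theorem bvMix_inl_right {n : ℕ} {p : BVState n} {c : Control (n + 1)} (h : p ≠ .inl c) :
    bvMix n p (.inl c) = 0 := by
  rcases p with p | p
  · simp only [bvMix, Matrix.fromBlocks_apply₁₁]
    classical exact Matrix.one_apply_ne fun hp => h (congrArg _ hp)
  · simp [bvMix]

theorem bvMix_inl_left {n : ℕ} {p : BVState n} {c : Control (n + 1)} (h : p ≠ .inl c) :
    bvMix n (.inl c) p = 0 := by
  rcases p with p | p
  · simp only [bvMix, Matrix.fromBlocks_apply₁₁]
    classical exact Matrix.one_apply_ne fun hp => h (congrArg _ hp.symm)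
  · simp [bvMix]

theorem bvMix_inr {n : ℕ} (k l : Bool) (r r' : Fin (n + 1) → Bool) :
    bvMix n (.inr (k, r)) (.inr (l, r')) =
      if k = l then hadamardTransform _ r r' else 0 := by
  simp [bvMix, Matrix.one_apply]

theorem isAlgebraic_bvMix (n : ℕ) (p q : BVState n) : IsAlgebraic ℚ (bvMix n p q) := by
  classical
  have h1 : ∀ (α : Type) [DecidableEq α] (a b : α),
      IsAlgebraic ℚ ((1 : Matrix α α ℂ) a b) := by
    intro α _ a b
    rw [Matrix.one_apply]
    split_ifs
    · exact isAlgebraic_one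
    · exact isAlgebraic_zero
  rcases p with p | ⟨k, p⟩ <;> rcases q with q | ⟨l, q⟩
  · exact h1 (Control (n + 1)) _ _
  · exact isAlgebraic_zero
  · exact isAlgebraic_zero
  · exact (h1 Bool k l).mul (isAlgebraic_hadamardTransform _ _)

theorem exists_bvPerm (n : ℕ) :
    ∃ e : Equiv.Perm (BVState n × (Fin 3 → TapeSymbol Empty)),
      ∀ s i q o s' i' q' o', BVRule n s i q o s' i' q' o' →
        e (s, ![i, q, o]) = (s', ![i', q', o']) := by
  have ext : ∀ a b : BVState n × (Fin 3 → TapeSymbol Empty),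
      (a.1, a.2 0, a.2 1, a.2 2) = (b.1, b.2 0, b.2 1, b.2 2) → a = b := by
    intro a b h
    simp only [Prod.mk.injEq] at h
    refine Prod.ext h.1 (funext fun i => ?_)
    fin_cases i
    exacts [h.2.1, h.2.2.1, h.2.2.2]
  obtain ⟨e, he⟩ := exists_perm_of_biunique
    (fun a b : BVState n × (Fin 3 → TapeSymbol Empty) =>
      BVRule n a.1 (a.2 0) (a.2 1) (a.2 2) b.1 (b.2 0) (b.2 1) (b.2 2))
    (fun a b b' h h' => ext _ _ (h.functional h')) (fun a a' b h h' => ext _ _ (h.injective h'))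
  exact ⟨e, fun s i q o s' i' q' o' h => he (s, ![i, q, o]) (s', ![i', q', o']) h⟩

/-- A reversible transition that extends the rules. -/
noncomputable def bvPerm (n : ℕ) : Equiv.Perm (BVState n × (Fin 3 → TapeSymbol Empty)) :=
  (exists_bvPerm n).choose

theorem bvPerm_of_rule {n : ℕ} {s s' : BVState n} {i q o i' q' o'}
    (h : BVRule n s i q o s' i' q' o') :
    bvPerm n (s, ![i, q, o]) = (s', ![i', q', o']) :=
  (exists_bvPerm n).choose_spec _ _ _ _ _ _ _ _ h

open Classical in
/-- The machine that runs the Bernstein–Vazirani algorithm on a register of `n` bits and an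
answer bit: it copies its input to the query tape, appends `11` and the register in superposition,
makes the query, reads the register back, and writes its first `n` bits on the output tape. -/
noncomputable def bvMachine (n : ℕ) : OracleQTM where
  Q := BVState n
  fintypeQ := inferInstance
  E := Empty
  fintypeE := inferInstance
  work := 0
  start := .inl .copy
  pre := .inl .pre
  post := .inl .post
  -- By then `n` bits are written and only the answer bit, which the second transform returns to
  -- `1`, is left; it is not output.
  halt := .inl (.output ⟨[true], by simp⟩)
  δ := fun q s a => ∑ p : BVState n,
    if a = ((bvPerm n (p, s)).1, (bvPerm n (p, s)).2, bvDir n (bvPerm n (p, s)).1) then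
      bvMix n p q else 0

/-- The machine is unidirectional. -/
noncomputable def bvUnidirectional (n : ℕ) : (bvMachine n).Unidirectional where
  mix := bvMix n
  rule := bvPerm n
  dir := bvDir n
  conjTranspose_mul_mix := @bvMix_conjTranspose_mul n fun _ _ => Classical.propDecidable _
  mix_pre_left := by
    intro q
    split_ifs with h
    · rw [h]
      exact bvMix_inl_self _
    · exact bvMix_inl_left h
  mix_pre_right := by
    intro q
    split_ifs with h
    · rw [h]
      exact bvMix_inl_self _
    · exact bvMix_inl_right h
  rule_pre := by
    intro s
    have hs : s = ![s 0, s 1, s 2] := by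
      funext i
      fin_cases i <;> rfl
    rw [hs]
    exact bvPerm_of_rule (.query _ _ _)
  dir_post := by
    funext i
    fin_cases i <;> rfl
  δ_eq := by
    intro q s a
    refine Finset.sum_congr rfl fun p _ => ?_
    congr

open OracleQTM

/-! ### The computation -/

/-- The configuration with strings on the three tapes and given head positions. -/
noncomputable def bvCfg {n : ℕ} (s : BVState n) (w u v : List Bool) (i j k : ℤ) :
    (bvMachine n).Cfg :=
  ⟨s, ![stringTape Empty w, stringTape Empty u, stringTape Empty v], ![i, j, k]⟩

theorem init_bvMachine (n : ℕ) (w : List Bool) :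
    (bvMachine n).init w = bvCfg (.inl .copy) w [] [] 0 0 0 := by
  apply Cfg.ext
  · rfl
  · funext t
    fin_cases t
    · rfl
    · exact stringTape_nil.symm
    · exact stringTape_nil.symm
  · funext t
    fin_cases t <;> rfl

open Classical in
theorem query_bvCfg {n : ℕ} (A : Set (List Bool)) (s : BVState n) (w x v : List Bool) (b : Bool)
    (i j k : ℤ) :
    (bvCfg s w (x ++ [b]) v i j k).query A =
      bvCfg (.inl .post) w (x ++ [xor b (decide (x ∈ A))]) v i j k := by
  apply Cfg.ext
  · rfl
  · funext t
    fin_cases t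
    · rfl
    · exact oracleTape_stringTape A x b
    · rfl
  · rfl

section

variable {n : ℕ} {A : Set (List Bool)} {w u u' v v' : List Bool} {i j k i' j' k' : ℤ}

theorem next_bvCfg {s s' : BVState n} (hs : s ≠ .inl .pre) {b c}
    (hr : BVRule n s (stringTape Empty w i) (stringTape Empty u j) (stringTape Empty v k)
      s' (stringTape Empty w i) b c)
    (hu : (stringTape Empty u).update j b = stringTape Empty u')
    (hv : (stringTape Empty v).update k c = stringTape Empty v')
    (hi : i + (bvDir n s' 0 : ℤ) = i') (hj : j + (bvDir n s' 1 : ℤ) = j')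
    (hk : k + (bvDir n s' 2 : ℤ) = k') :
    (bvUnidirectional n).next A (bvCfg s w u v i j k) = bvCfg s' w u' v' i' j' k' := by
  have hscan : (bvCfg s w u v i j k).scan =
      ![stringTape Empty w i, stringTape Empty u j, stringTape Empty v k] := by
    funext t
    fin_cases t <;> rfl
  have hrule : (bvUnidirectional n).rule ((bvCfg s w u v i j k).state,
      (bvCfg s w u v i j k).scan) = (s', ![stringTape Empty w i, b, c]) := by
    rw [hscan]
    exact bvPerm_of_rule hr
  rw [Unidirectional.next_of_rule _ A (by exact hs) hrule]
  apply Cfg.ext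
  · rfl
  · funext t
    fin_cases t
    · exact Finsupp.update_self _ _
    · exact hu
    · exact hv
  · funext t
    fin_cases t
    · exact hi
    · exact hj
    · exact hk

theorem chain_bvCfg {s : Control (n + 1)} {s' : BVState n} (hs : s ≠ .pre)
    (hh : s ≠ .output ⟨[true], by simp⟩) {b c}
    (hr : BVRule n (.inl s) (stringTape Empty w i) (stringTape Empty u j) (stringTape Empty v k)
      s' (stringTape Empty w i) b c)
    (hu : (stringTape Empty u).update j b = stringTape Empty u')
    (hv : (stringTape Empty v).update k c = stringTape Empty v')
    (hi : i + (bvDir n s' 0 : ℤ) = i') (hj : j + (bvDir n s' 1 : ℤ) = j')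
    (hk : k + (bvDir n s' 2 : ℤ) = k') :
    Chain A 1 0 (bvCfg (.inl s) w u v i j k) (bvCfg s' w u' v' i' j' k') := by
  have hp : (Sum.inl s : BVState n) ≠ .inl .pre := fun h => hs (Sum.inl_injective h)
  refine Chain.of_step ?_ (fun h => hh (Sum.inl_injective h)) hp
  rw [← next_bvCfg (A := A) hp hr hu hv hi hj hk]
  exact Unidirectional.step_eq_single _ A (fun p h => bvMix_inl_right h) (bvMix_inl_self s)

theorem chain_copy (rest : List Bool) :
    Chain A rest.length 0 (bvCfg (n := n) (.inl .copy) (u ++ rest) u [] u.length u.length 0)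
      (bvCfg (.inl .copy) (u ++ rest) (u ++ rest) [] (u ++ rest).length (u ++ rest).length 0) := by
  induction rest generalizing u with
  | nil => simpa using Chain.refl _
  | cons b rest ih =>
    have h := ih (u := u ++ [b])
    rw [List.append_assoc, List.singleton_append] at h
    have h1 : Chain A 1 0
        (bvCfg (n := n) (.inl .copy) (u ++ b :: rest) u [] u.length u.length 0)
        (bvCfg (.inl .copy) (u ++ b :: rest) (u ++ [b]) [] (u ++ [b]).length
          (u ++ [b]).length 0) := by
      refine chain_bvCfg (by simp) (by simp) ?_ (stringTape_update_length u b)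
        (Finsupp.update_self _ _) ?_ ?_ ?_
      · rw [stringTape_append_cons, stringTape_length]
        exact .copyBit b _
      · simp [bvDir]
      · simp [bvDir]
      · simp [bvDir]
    rw [List.length_cons, add_comm]
    exact h1.trans h

theorem chain_mark :
    Chain A 2 0 (bvCfg (n := n) (.inl .copy) w w [] w.length w.length 0)
      (bvCfg (.inr (false, initialRegister n)) w (w ++ [true, true]) [] w.length
        (w ++ [true, true]).length 0) := by
  have h1 : Chain A 1 0 (bvCfg (n := n) (.inl .copy) w w [] w.length w.length 0)
      (bvCfg (.inl .mark) w (w ++ [true]) [] w.length (w ++ [true]).length 0) := by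
    refine chain_bvCfg (by simp) (by simp) ?_ (stringTape_update_length w true)
      (Finsupp.update_self _ _) ?_ ?_ ?_
    · rw [stringTape_length]
      exact .copyEnd _
    · simp [bvDir]
    · simp [bvDir]
    · simp [bvDir]
  refine h1.trans (chain_bvCfg (b := .bit true) (by simp) (by simp) ?_ ?_
    (Finsupp.update_self _ _) ?_ ?_ ?_)
  · rw [stringTape_length, stringTape_length]
    exact .mark _ _
  · rw [stringTape_update_length]
    simp
  · simp [bvDir]
  · simp [bvDir, add_assoc]
  · simp [bvDir]

theorem chain_write (l : BoundedString (n + 1)) :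
    Chain A l.1.length 0 (bvCfg (n := n) (.inl (.write l)) w u v i u.length k)
      (bvCfg (.inl (.write ⟨[], by simp⟩)) w (u ++ l.1) v i (u ++ l.1).length k) := by
  obtain ⟨l, hl⟩ := l
  induction l generalizing u with
  | nil => simpa using Chain.refl _
  | cons b l ih =>
    have hl' : l.length ≤ n + 1 := by simp at hl; omega
    have h := ih (u := u ++ [b]) hl'
    simp only [List.append_assoc, List.singleton_append] at h
    have h1 : Chain A 1 0 (bvCfg (n := n) (.inl (.write ⟨b :: l, hl⟩)) w u v i u.length k)
        (bvCfg (.inl (.write ⟨l, hl'⟩)) w (u ++ [b]) v i (u ++ [b]).length k) := by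
      refine chain_bvCfg (by simp) (by simp) ?_ (stringTape_update_length u b)
        (Finsupp.update_self _ _) ?_ ?_ ?_
      · rw [stringTape_length]
        exact .write b _ _ _ _ rfl
      · simp [bvDir]
      · have : l.length ≠ n + 1 := by simp at hl; omega
        simp [bvDir, this]
      · simp [bvDir]
    rw [List.length_cons, add_comm]
    exact h1.trans h

open Classical in
theorem chain_query {x : List Bool} {b : Bool} :
    Chain A 3 1
      (bvCfg (n := n) (.inl (.write ⟨[], by simp⟩)) w (x ++ [b]) v i (x ++ [b]).length k)
      (bvCfg (.inl (.read ⟨[], by simp⟩)) w (x ++ [xor b (decide (x ∈ A))]) v i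
        ((x ++ [xor b (decide (x ∈ A))]).length - 1) k) := by
  have h1 : Chain A 1 0
      (bvCfg (n := n) (.inl (.write ⟨[], by simp⟩)) w (x ++ [b]) v i (x ++ [b]).length k)
      (bvCfg (.inl .pre) w (x ++ [b]) v i (x ++ [b]).length k) := by
    refine chain_bvCfg (by simp) (by simp) ?_ (Finsupp.update_self _ _)
      (Finsupp.update_self _ _) ?_ ?_ ?_
    · rw [stringTape_length]
      exact .writeEnd _ _ _ rfl
    · simp [bvDir]
    · simp [bvDir]
    · simp [bvDir]
  have h2 : Chain A 1 1 (bvCfg (n := n) (.inl .pre) w (x ++ [b]) v i (x ++ [b]).length k)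
      (bvCfg (.inl .post) w (x ++ [xor b (decide (x ∈ A))]) v i (x ++ [b]).length k) := by
    rw [← query_bvCfg A (.inl .pre)]
    exact Chain.of_query rfl fun h => by cases Sum.inl_injective h
  refine (h1.trans h2).trans (k' := 1) (m' := 0) (chain_bvCfg (by simp) (by simp)
    (.readStart _ _ _ _ rfl) (Finsupp.update_self _ _) (Finsupp.update_self _ _) ?_ ?_ ?_)
  · simp [bvDir]
  · simp [bvDir]
  · simp [bvDir]

/-- `l'` is what has been read so far. The head runs leftwards, so the induction takes the last bit
off `l` and puts it in front of `l'`. -/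
theorem chain_read (l l' : List Bool) (hl : (l ++ l').length ≤ n + 1) :
    Chain A l.length 0
      (bvCfg (n := n) (.inl (.read ⟨l', by simp at hl; omega⟩)) w (u ++ l) v i
        ((u ++ l).length - 1) k)
      (bvCfg (.inl (.read ⟨l ++ l', hl⟩)) w u v i (u.length - 1) k) := by
  induction l using List.reverseRecOn generalizing l' with
  | nil => simpa using Chain.refl _
  | append_singleton l b ih =>
    have hl1 : (l ++ b :: l').length ≤ n + 1 := by simpa using hl
    have h := ih (b :: l') hl1
    have h1 : Chain A 1 0
        (bvCfg (n := n) (.inl (.read ⟨l', by simp at hl; omega⟩)) w (u ++ (l ++ [b])) v i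
          ((u ++ (l ++ [b])).length - 1) k)
        (bvCfg (.inl (.read ⟨b :: l', by simp at hl ⊢; omega⟩)) w (u ++ l) v i
          ((u ++ l).length - 1) k) := by
      have hlen : ((u ++ (l ++ [b])).length : ℤ) - 1 = (u ++ l).length := by
        simp only [List.length_append, List.length_singleton]
        push_cast
        ring
      rw [hlen, ← List.append_assoc]
      refine chain_bvCfg (by simp) (by simp) ?_ (stringTape_erase_last _ b)
        (Finsupp.update_self _ _) ?_ ?_ ?_
      · rw [stringTape_append_cons]
        exact .read b _ _ _ _ rfl
      · simp [bvDir]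
      · simp [bvDir]
        rfl
      · simp [bvDir]
    have h2 := h1.trans h
    rw [add_comm] at h2
    simpa only [List.append_assoc, List.singleton_append, List.length_append,
      List.length_singleton] using h2

theorem chain_output (l : List Bool) (b : Bool) (hl : (l ++ [b]).length ≤ n + 1) :
    Chain A l.length 0
      (bvCfg (n := n) (.inl (.output ⟨l ++ [b], hl⟩)) w u v i j v.length)
      (bvCfg (.inl (.output ⟨[b], by simp⟩)) w u (v ++ l) i j (v ++ l).length) := by
  induction l generalizing v with
  | nil => simpa using Chain.refl _
  | cons c l ih =>
    have hl' : (l ++ [b]).length ≤ n + 1 := by simp at hl ⊢; omega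
    have h := ih (v := v ++ [c]) hl'
    simp only [List.append_assoc, List.singleton_append] at h
    have h1 : Chain A 1 0
        (bvCfg (n := n) (.inl (.output ⟨c :: l ++ [b], hl⟩)) w u v i j v.length)
        (bvCfg (.inl (.output ⟨l ++ [b], hl'⟩)) w u (v ++ [c]) i j (v ++ [c]).length) := by
      refine chain_bvCfg (by simp) (by simp) ?_ (Finsupp.update_self _ _)
        (stringTape_update_length v c) ?_ ?_ ?_
      · rw [stringTape_length v]
        exact .output c _ _ _ _ rfl
      · simp [bvDir]
      · simp [bvDir]
      · have : l.length ≠ n := by simp at hl; omega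
        simp [bvDir, this]
    rw [List.length_cons, add_comm]
    exact h1.trans h

theorem ofFn_eq_init_append_last (r : Fin (n + 1) → Bool) :
    List.ofFn r = List.ofFn (Fin.init r) ++ [r (Fin.last n)] := by
  rw [List.ofFn_succ', List.concat_eq_append]
  rfl

/-- The register after a query to `A` with the prefix `y`. -/
theorem chain_register {y : List Bool} {r r' : Fin (n + 1) → Bool} (hi' : Fin.init r' = Fin.init r)
    (hl' : r' (Fin.last n) = xor (r (Fin.last n))
      (@decide (y ++ List.ofFn (Fin.init r) ∈ A) (Classical.propDecidable _))) :
    Chain A (2 * n + 6) 1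
      (bvCfg (.inl (.write ⟨List.ofFn r, by simp⟩)) w y v i y.length k)
      (bvCfg (.inr (true, r')) w y v i (y.length - 1) k) := by
  have h1 := chain_write (A := A) (w := w) (u := y) (v := v) (i := i) (k := k) (n := n)
    ⟨List.ofFn r, by simp⟩
  simp only at h1
  have e1 : y ++ List.ofFn r = (y ++ List.ofFn (Fin.init r)) ++ [r (Fin.last n)] := by
    rw [ofFn_eq_init_append_last r, List.append_assoc]
  have e2 : (y ++ List.ofFn (Fin.init r)) ++ [xor (r (Fin.last n))
      (@decide (y ++ List.ofFn (Fin.init r) ∈ A) (Classical.propDecidable _))] =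
        y ++ List.ofFn r' := by
    rw [ofFn_eq_init_append_last r', List.append_assoc, hl', hi']
  have h2 := chain_query (n := n) (A := A) (w := w) (v := v) (i := i) (k := k)
    (x := y ++ List.ofFn (Fin.init r)) (b := r (Fin.last n))
  rw [e2, ← e1] at h2
  have h3 := chain_read (n := n) (A := A) (w := w) (u := y) (v := v) (i := i) (k := k)
    (List.ofFn r') [] (by simp)
  simp only [List.append_nil] at h3
  have h4 : Chain A 1 0
      (bvCfg (.inl (.read ⟨List.ofFn r', by simp⟩)) w y v i (y.length - 1) k)
      (bvCfg (.inr (true, r')) w y v i (y.length - 1) k) := by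
    refine chain_bvCfg (by simp) (by simp) (.readEnd _ _ _ _ _ rfl) (Finsupp.update_self _ _)
      (Finsupp.update_self _ _) ?_ ?_ ?_
    · simp [bvDir]
    · simp [bvDir]
    · simp [bvDir]
  -- The steps are `n + 1` for writing, `3` around the query, `n + 1` for reading and `1` for
  -- returning to the register.
  have h := ((h1.trans h2).trans h3).trans h4
  simp only [List.length_ofFn] at h
  convert h using 1
  ring

theorem step_hadamard {b : Bool} {r : Fin (n + 1) → Bool} {f : (Fin (n + 1) → Bool) → _}
    (hf : ∀ r', (bvUnidirectional n).next A (bvCfg (.inr (b, r')) w u v i j k) = f r') :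
    (bvMachine n).step A (bvCfg (.inr (b, r)) w u v i j k) =
      ∑ r', Finsupp.single (f r') (hadamardTransform _ r' r) := by
  have h : (bvMachine n).step A (bvCfg (.inr (b, r)) w u v i j k) =
      ∑ p : BVState n, Finsupp.single ((bvUnidirectional n).next A (bvCfg p w u v i j k))
        (bvMix n p (.inr (b, r))) := Unidirectional.step_eq (bvUnidirectional n) A _
  rw [h, Fintype.sum_sum_type, Finset.sum_eq_zero, zero_add, Fintype.sum_prod_type,
    Finset.sum_eq_single_of_mem b (Finset.mem_univ _)]
  · refine Finset.sum_congr rfl fun r' _ => ?_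
    rw [hf, bvMix_inr, if_pos rfl]
  · intro c _ hc
    refine Finset.sum_eq_zero fun r' _ => ?_
    rw [bvMix_inr, if_neg hc, Finsupp.single_zero]
  · intro p _
    rw [bvMix_inl_left (by simp), Finsupp.single_zero]

theorem safe_hadamard {b : Bool} {r : Fin (n + 1) → Bool} {f : (Fin (n + 1) → Bool) → _}
    (hf : ∀ r', (bvUnidirectional n).next A (bvCfg (.inr (b, r')) w u v i j k) = f r')
    {t m : ℕ} (hs : ∀ r', Safe A t m (f r')) :
    Safe A (t + 1) m (bvCfg (.inr (b, r)) w u v i j k) := by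
  refine ⟨fun h => ?_, fun c hc => Or.inr ⟨fun h => ?_, ?_⟩⟩
  · exact Sum.inr_ne_inl h
  · exact Sum.inr_ne_inl h
  · rw [step_hadamard hf, Finsupp.finsetSum_apply] at hc
    obtain ⟨r', _, hr'⟩ := Finset.exists_ne_zero_of_sum_ne_zero hc
    have : c = f r' := by
      by_contra hne
      exact hr' (Finsupp.single_eq_of_ne hne)
    exact this ▸ hs r'

theorem next_load (r : Fin (n + 1) → Bool) :
    (bvUnidirectional n).next A (bvCfg (.inr (false, r)) w u v i j k) =
      bvCfg (.inl (.write ⟨List.ofFn r, by simp⟩)) w u v i j k := by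
  refine next_bvCfg (by simp) (.load _ _ _ _ _ rfl) (Finsupp.update_self _ _)
    (Finsupp.update_self _ _) ?_ ?_ ?_ <;> simp [bvDir]

theorem next_unload (r : Fin (n + 1) → Bool) :
    (bvUnidirectional n).next A (bvCfg (.inr (true, r)) w u v i j k) =
      bvCfg (.inl (.output ⟨List.ofFn r, by simp⟩)) w u v i j k := by
  refine next_bvCfg (by simp) (.unload _ _ _ _ _ rfl) (Finsupp.update_self _ _)
    (Finsupp.update_self _ _) ?_ ?_ ?_ <;> simp [bvDir]

end

/-! ### The complete run with the oracle of inner products -/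

theorem kickback_last {A : Set (List Bool)} {n : ℕ} (z : Fin n → List Bool)
    (r : Fin (n + 1) → Bool) :
    kickback (charVec A n z) r (Fin.last n) = xor (r (Fin.last n))
      (@decide (encodeTuple z ++ [true, true] ++ List.ofFn (Fin.init r) ∈ innerProductOracle A)
        (Classical.propDecidable _)) := by
  rw [kickback, Fin.snoc_last]
  congr 1
  rw [decide_eq_decide]
  exact encodePair_mem_innerProductOracle.symm

section

variable {n : ℕ} (A : Set (List Bool)) (z : Fin n → List Bool)

/-- At the end the tapes and heads no longer depend on `r`; only therefore can the second transform
make the branches interfere. -/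
theorem chain_bvMachine_kickback (w : List Bool) (i : ℤ) (r : Fin (n + 1) → Bool) :
    Chain (innerProductOracle A) (2 * n + 6) 1
      (bvCfg (.inl (.write ⟨List.ofFn r, by simp⟩)) w (encodeTuple z ++ [true, true]) [] i
        (encodeTuple z ++ [true, true]).length 0)
      (bvCfg (.inr (true, kickback (charVec A n z) r)) w (encodeTuple z ++ [true, true]) [] i
        ((encodeTuple z ++ [true, true]).length - 1) 0) :=
  chain_register (by simp [kickback]) (kickback_last z r)

theorem chain_bvMachine_output (X : Set (List Bool)) (w u : List Bool) (i j : ℤ)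
    (r : Fin (n + 1) → Bool) :
    Chain X n 0 (bvCfg (n := n) (.inl (.output ⟨List.ofFn r, by simp⟩)) w u [] i j 0)
      (bvCfg (.inl (.output ⟨[r (Fin.last n)], by simp⟩)) w u (List.ofFn (Fin.init r)) i j n) := by
  have h := chain_output (n := n) (A := X) (w := w) (u := u) (v := []) (i := i) (j := j)
    (List.ofFn (Fin.init r)) (r (Fin.last n)) (by simp)
  simpa only [← ofFn_eq_init_append_last, List.nil_append, List.length_ofFn, List.length_nil,
    Nat.cast_zero] using h

theorem chain_bvMachine_start (X : Set (List Bool)) (w : List Bool) :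
    Chain X (w.length + 2) 0 ((bvMachine n).init w)
      (bvCfg (.inr (false, initialRegister n)) w (w ++ [true, true]) [] w.length
        (w ++ [true, true]).length 0) := by
  rw [init_bvMachine]
  have h := chain_copy (n := n) (A := X) (u := []) w
  simp only [List.nil_append, List.length_nil, Nat.cast_zero] at h
  exact h.trans chain_mark

/-- The running time on inputs of length `m`. -/
def bvTime (n m : ℕ) : ℕ := m + 2 + (2 * n + 6 + (n + 1) + 1)

/-- This covers every path, including those whose amplitudes cancel in the second transform, about
which the final superposition says nothing. -/
theorem safe_bvMachine :
    Safe (innerProductOracle A) (bvTime n (encodeTuple z).length) 1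
      ((bvMachine n).init (encodeTuple z)) := by
  refine (chain_bvMachine_start _ _).safe (2 * n + 6 + (n + 1) + 1) 1 ?_
  refine safe_hadamard next_load fun r => ?_
  refine (chain_bvMachine_kickback A z _ _ r).safe (n + 1) 0 ?_
  refine safe_hadamard next_unload fun r' => ?_
  exact (chain_bvMachine_output _ _ _ _ _ r').safe 0 0 trivial

theorem run_bvMachine :
    (bvMachine n).run (innerProductOracle A) (encodeTuple z) (bvTime n (encodeTuple z).length) =
      Finsupp.single (bvCfg (.inl (.output ⟨[true], by simp⟩)) (encodeTuple z)
        (encodeTuple z ++ [true, true]) (List.ofFn (charVec A n z)) (encodeTuple z).length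
        ((encodeTuple z ++ [true, true]).length - 1) n) 1 := by
  have hsingle : ∀ (c : (bvMachine n).Cfg) (x : ℂ),
      (bvMachine n).evolve (innerProductOracle A) (Finsupp.single c x) =
        x • (bvMachine n).step (innerProductOracle A) c := fun c x => by
    rw [evolve, Finsupp.linearCombination_single]
  -- Iterates compose from right to left, so the phases appear in reverse: start, transform, query
  -- phase, transform, output.
  have ht : bvTime n (encodeTuple z).length =
      n + (1 + (2 * n + 6 + (1 + ((encodeTuple z).length + 2)))) := by
    unfold bvTime
    ring
  rw [run, ht]
  rw [Function.iterate_add_apply _ n, Function.iterate_add_apply _ 1,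
    Function.iterate_add_apply _ (2 * n + 6), Function.iterate_add_apply _ 1,
    (chain_bvMachine_start _ _).evolve_iterate, Function.iterate_one, hsingle, one_smul,
    step_hadamard next_load, Chain.evolve_iterate_sum (chain_bvMachine_kickback A z _ _), map_sum]
  simp only [hsingle, step_hadamard next_unload, Finset.smul_sum, Finsupp.smul_single, smul_eq_mul]
  -- Exchanging the sums collects the amplitude of each final register, to which the
  -- Bernstein–Vazirani identity applies.
  rw [Finset.sum_comm]
  simp only [← Finsupp.single_finsetSum, initialRegister, sum_hadamardTransform_kickback]
  rw [Finset.sum_eq_single_of_mem _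
    (Finset.mem_univ (Fin.snoc (α := fun _ => Bool) (charVec A n z) true)), if_pos rfl,
    (chain_bvMachine_output _ _ _ _ _ _).evolve_iterate]
  · simp only [Fin.snoc_last, Fin.init_snoc]
  · intro r _ hr
    rw [if_neg hr, Finsupp.single_zero]

end

/-! ### One query suffices, and no set is superterse -/

theorem charVec_mem_FEQP (A : Set (List Bool)) (n : ℕ) :
    charVec A n ∈ FEQP encodeTuple List.ofFn (innerProductOracle A) fun _ => 1 := by
  refine ⟨bvMachine n, (bvUnidirectional n).wellFormed,
    (bvUnidirectional n).algebraicAmplitudes (isAlgebraic_bvMix n),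
    Polynomial.X + Polynomial.C (2 + (2 * n + 6 + (n + 1) + 1)), fun z =>
    ⟨bvTime n (encodeTuple z).length, ?_, ⟨?_, ?_⟩, ?_, ?_⟩⟩
  · rw [Polynomial.eval_add, Polynomial.eval_X, Polynomial.eval_C, bvTime, add_assoc]
  · intro c hc
    rw [run_bvMachine] at hc
    obtain rfl := Finset.mem_singleton.1 (Finsupp.support_single_subset hc)
    rfl
  · intro t ht c hc
    exact (safe_bvMachine A z).state_ne_halt ht hc
  · rw [outputProb, run_bvMachine, Finsupp.support_single _ one_ne_zero, Finset.filter_singleton,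
      if_pos (by rfl), Finset.sum_singleton, Finsupp.single_eq_same, norm_one, one_pow]
  · intro γ hγ
    exact (safe_bvMachine A z).card_le γ hγ.1 hγ.2

theorem theorem5 (A : Set (List Bool)) :
    (∃ X : Set (List Bool),
      (∀ w : List Bool, w ∈ X ↔
        ∃ (n : ℕ) (z : Fin n → List Bool) (x : Fin n → Bool),
          w = encodePair z x ∧ bitInner (charVec A n z) x ≡ 1 [MOD 2]) ∧
      ∀ n : ℕ, charVec A n ∈ FEQP encodeTuple List.ofFn X fun _ => 1) ∧
    ¬ IsEQPSuperterse A :=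
  ⟨⟨innerProductOracle A, fun _ => Iff.rfl, charVec_mem_FEQP A⟩,
    -- For `n = 2` the permitted `n - 1` queries are exactly the one that suffices.
    fun h => h 2 one_le_two (innerProductOracle A) (charVec_mem_FEQP A 2)⟩
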